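/- **Setting.** Let $c=(c_n)_{n\in\mathbb Z}$ be a sequence of quaternions with $c_0=1$ which is a non-trivial positive definite sequence: for every $n\ge 0$ the Toeplitz matrix $[c_{l-k}]_{k,l=0}^n$ satisfies $\sum_{k,l}\overline{\xi_k}\,c_{l-k}\,\xi_l>0$ for all $0\ne\xi\in\mathbb H^{n+1}$. For example, $c$ may be the moment sequence $c_n=\int_0^{2\pi}e^{in\theta}\,d\mu_i(\theta)$ of a non-trivial $q$-positive probability measure $\mu_i$. Here $i,j$ are orthogonal purely imaginary unit quaternions, $\mathbb C_i=\mathbb R+\mathbb R i$, and $\mu_i=\mu^{(1)}+\mu^{(2)}j$ is a quaternion-valued measure on the unit circle of $\mathbb C_i$ with $\mathbb C_i$-valued components, such that $\mu^{(1)}\ge 0$, $\int e^{in\theta}d\mu^{(2)}=-\int e^{-in\theta}d\mu^{(2)}$ for all $n\in\mathbb Z$, and $\begin{bmatrix}\mu^{(1)}&\mu^{(2)}\\ \overline{\mu^{(2)}}&\nu\end{bmatrix}$ is positive semidefinite-valued, where $\nu$ is the $\mathbb C_i$-valued measure with $\int e^{in\theta}d\nu=\int e^{-in\theta}d\mu^{(1)}$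 for all $n\in\mathbb Z$. The measure is non-trivial if its moment sequence is, and it is a probability measure if $c_0=1$. **Orthonormal polynomials.** For polynomials $\varphi(p)=\sum_k\varphi_kp^k$, $\psi(p)=\sum_l\psi_lp^l$ with left coefficients put $\langle\varphi,\psi\rangle_L=\sum_{k,l}\varphi_k\,c_{k-l}\,\overline{\psi_l}$; for polynomials $\varphi(p)=\sum_kp^k\varphi_k$, $\psi(p)=\sum_lp^l\psi_l$ with right coefficients put $\langle\varphi,\psi\rangle_R=\sum_{k,l}\overline{\psi_l}\,c_{k-l}\,\varphi_k$. Let $(\psi_n^L)_{n\ge0}$ (left coefficients) and $(\psi_n^R)_{n\ge0}$ (right coefficients) be obtained from $1,p,p^2,\dots$ by the Gram–Schmidt algorithm with respect to $\langle\cdot,\cdot\rangle_L$ and $\langle\cdot,\cdot\rangle_R$ respectively (the Gram–Schmidt coefficients multiplying on the left, respectively on the right). Writing $\psi^L_n(p)=\sum_k a_kp^k$ and $\psi_n^R(p)=\sum_kp^kb_k$, define the reverse polynomials $$\psi_n^{L,\#}(p)=\sum_{k=0}^np^{n-k}\,\overline{a_k},\qquad \psi_n^{R,\#}(p)=\sum_{k=0}^n\overline{b_k}\,p^{n-k};$$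 equivalently, $\psi_n^{L,\#}(p)=p^n\,\overline{\psi_n^L(1/\overline p)}$ and $\psi_n^{R,\#}(p)=\overline{\psi_n^R(1/\overline p)}\,p^n$ for $p\neq0$. **Verblunsky coefficients.** Let $\star$ denote the product of power series $\sum_kp^ka_k$ by convolution of coefficients, $(\cdot)^{-\star}$ the inverse for this product, and $F(p)=1+2\sum_{k\ge1}p^kc_{-k}$ (on the unit disc of $\mathbb C_i$ this is $\int_0^{2\pi}(1+ze^{-i\theta})(1-ze^{-i\theta})^{-1}d\mu_i(\theta)$). Let $f$ be the Schur function with $p\,f=(F-1)\star(F+1)^{-\star}$, put $f_0=f$ and $$\gamma_n=f_n(0),\qquad f_{n+1}(p)=p^{-1}\,(f_n-\gamma_n)\star(1-\overline{\gamma_n}\star f_n)^{-\star}(p).$$ **Claim.** For every $n\ge0$ we have $|\gamma_n|<1$, so that $r_n:=\sqrt{1-|\gamma_n|^2}>0$, and for all $p\in\mathbb H$ $$\psi_{n+1}^L(p)=r_n^{-1}\big(\psi_n^L(p)\,p-\overline{\gamma_n}\,\psi_n^{R,\#}(p)\big),\qquad \psi_{n+1}^{L,\#}(p)=r_n^{-1}\big(\psi_n^{L,\#}(p)-p\,\psi_n^R(p)\,\gamma_n\big),$$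 $$\psi_{n+1}^R(p)=r_n^{-1}\big(p\,\psi_n^R(p)-\psi_n^{L,\#}(p)\,\overline{\gamma_n}\big),\qquad \psi_{n+1}^{R,\#}(p)=r_n^{-1}\big(\psi_n^{R,\#}(p)-\gamma_n\,\psi_n^L(p)\,p\big).$$ -/

import Mathlib

open scoped Quaternion Polynomial

noncomputable section

namespace QuatOPUC

/-! ### Quaternions, slices and positivity -/

/-- The sphere of purely imaginary unit quaternions. -/
def imagSphere : Set ℍ[ℝ] := {q | q.re = 0 ∧ ‖q‖ = 1}

/-- The complex plane `ℝ + ℝ i` inside the quaternions. -/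
def slicePlane (i : ℍ[ℝ]) : Set ℍ[ℝ] := {q | ∃ a b : ℝ, q = (a : ℍ[ℝ]) + b • i}

/-- The unit circle of the plane `ℝ + ℝ i`. -/
def sliceCircle (i : ℍ[ℝ]) : Set ℍ[ℝ] := {q | q ∈ slicePlane i ∧ ‖q‖ = 1}

/-- The quaternion `q` is a nonnegative real number. -/
def IsNonnegReal (q : ℍ[ℝ]) : Prop := q.im = 0 ∧ 0 ≤ q.re

/-- The quaternion `q` is a strictly positive real number. -/
def IsPosReal (q : ℍ[ℝ]) : Prop := q.im = 0 ∧ 0 < q.re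

/-! ### Non-trivial positive definite sequences -/

/-- The Toeplitz matrix with `(k, l)` entry `c (l - k)`, `0 ≤ k, l ≤ n`. -/
def toeplitz (c : ℤ → ℍ[ℝ]) (n : ℕ) : Matrix (Fin (n + 1)) (Fin (n + 1)) ℍ[ℝ] :=
  Matrix.of fun k l => c ((l : ℕ) - (k : ℕ) : ℤ)

/-- `ξ* A ξ > 0` for every nonzero quaternionic column vector `ξ`. -/
def MatrixPosDef {n : ℕ} (A : Matrix (Fin n) (Fin n) ℍ[ℝ]) : Prop :=
  ∀ ξ : Fin n → ℍ[ℝ], ξ ≠ 0 → IsPosReal (star ξ ⬝ᵥ A.mulVec ξ)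

/-- Non-trivial positive definite sequences: all Toeplitz matrices are positive definite. -/
def IsNontrivialPosDef (c : ℤ → ℍ[ℝ]) : Prop := ∀ n : ℕ, MatrixPosDef (toeplitz c n)

/-! ### `q`-positive measures -/

instance : MeasurableSpace ℍ[ℝ] := borel ℍ[ℝ]

instance : BorelSpace ℍ[ℝ] := ⟨rfl⟩

/-- The moment `∫ e^{i n θ} dμ(θ)` of a quaternion-valued measure on the unit circle of
`ℝ + ℝ i`; the integrand multiplies the measure from the left. -/
def moment {i : ℍ[ℝ]} (μ : MeasureTheory.VectorMeasure (sliceCircle i) ℍ[ℝ]) (n : ℤ) : ℍ[ℝ] :=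
  μ.integral (fun q : sliceCircle i => (q : ℍ[ℝ]) ^ n) (ContinuousLinearMap.mul ℝ ℍ[ℝ])

/-- `μ = μ₁ + μ₂ j` is `q`-positive: `μ₁`, `μ₂`, `ν` take values in `ℝ + ℝ i`, `μ₁` is positive,
the moments of `ν` are those of `μ₁` in reversed order, the moments of `μ₂` are odd, and
the matrix-valued measure with rows `(μ₁, μ₂)`, `(conj μ₂, ν)` is positive semidefinite. -/
def IsQPositive (i j : ℍ[ℝ]) (μ : MeasureTheory.VectorMeasure (sliceCircle i) ℍ[ℝ]) : Prop :=
  ∃ μ₁ μ₂ ν : MeasureTheory.VectorMeasure (sliceCircle i) ℍ[ℝ],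
    (∀ A, μ₁ A ∈ slicePlane i ∧ μ₂ A ∈ slicePlane i ∧ ν A ∈ slicePlane i) ∧
    (∀ A, μ A = μ₁ A + μ₂ A * j) ∧
    (∀ A, IsNonnegReal (μ₁ A)) ∧
    (∀ n : ℤ, moment ν n = moment μ₁ (-n)) ∧
    (∀ n : ℤ, moment μ₂ n = -moment μ₂ (-n)) ∧
    (∀ A, ∀ x ∈ slicePlane i, ∀ y ∈ slicePlane i,
      IsNonnegReal (star x * μ₁ A * x + star x * μ₂ A * y
        + star y * star (μ₂ A) * x + star y * ν A * y))

/-- Non-triviality of a measure: its moment sequence is a non-trivial positive definite sequence. -/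
def IsNontrivialMeasure {i : ℍ[ℝ]}
    (μ : MeasureTheory.VectorMeasure (sliceCircle i) ℍ[ℝ]) : Prop :=
  IsNontrivialPosDef (moment μ)

/-! ### Slice hyperholomorphic polynomials

A polynomial over the quaternions (with a formal central variable) records the coefficients, and
gives rise to two functions of a quaternion variable. -/

/-- The function `p ↦ ∑ φ_k p^k` (coefficients on the left; right-slice hyperholomorphic). -/
def evalR (φ : ℍ[ℝ][X]) (p : ℍ[ℝ]) : ℍ[ℝ] := φ.sum fun k a => a * p ^ k

/-- The function `p ↦ ∑ p^k φ_k` (coefficients on the right; left-slice hyperholomorphic). -/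
def evalL (φ : ℍ[ℝ][X]) (p : ℍ[ℝ]) : ℍ[ℝ] := φ.sum fun k a => p ^ k * a

/-- The coefficients of the reverse polynomial: if `φ` has degree `n`, then the coefficient of
`p ^ (n - k)` is the conjugate of `φ_k`. Reversal exchanges left and right coefficients:
`evalL (reversePoly φ) p = p ^ n * conj (evalR φ (1 / conj p))` and
`evalR (reversePoly φ) p = conj (evalL φ (1 / conj p)) * p ^ n` for `p ≠ 0`. -/
def reversePoly (φ : ℍ[ℝ][X]) : ℍ[ℝ][X] :=
  φ.sum fun k a => Polynomial.monomial (φ.natDegree - k) (star a)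

theorem evalL_reversePoly (φ : ℍ[ℝ][X]) {p : ℍ[ℝ]} (hp : p ≠ 0) :
    evalL (reversePoly φ) p = p ^ φ.natDegree * star (evalR φ (star p)⁻¹) := by
  have h : ∀ s : Finset ℕ, ∀ g : ℕ → ℍ[ℝ][X],
      evalL (∑ k ∈ s, g k) p = ∑ k ∈ s, evalL (g k) p := by
    intro s g
    induction s using Finset.cons_induction with
    | empty => simp [evalL]
    | cons k s hk ih =>
      rw [Finset.sum_cons, Finset.sum_cons, ← ih]
      exact Polynomial.sum_add_index _ _ _ (by simp) (by intros; rw [mul_add])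
  rw [reversePoly, Polynomial.sum_def, h, evalR, Polynomial.sum_def, star_sum, Finset.mul_sum]
  refine Finset.sum_congr rfl fun k hk => ?_
  have hk' := Polynomial.le_natDegree_of_mem_supp k hk
  rw [evalL, Polynomial.sum_monomial_index _ _ (by simp), star_mul, star_pow, star_inv₀, star_star,
    ← mul_assoc, pow_sub₀ p hp hk', inv_pow]

theorem evalR_reversePoly (φ : ℍ[ℝ][X]) {p : ℍ[ℝ]} (hp : p ≠ 0) :
    evalR (reversePoly φ) p = star (evalL φ (star p)⁻¹) * p ^ φ.natDegree := by
  have h : ∀ s : Finset ℕ, ∀ g : ℕ → ℍ[ℝ][X],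
      evalR (∑ k ∈ s, g k) p = ∑ k ∈ s, evalR (g k) p := by
    intro s g
    induction s using Finset.cons_induction with
    | empty => simp [evalR]
    | cons k s hk ih =>
      rw [Finset.sum_cons, Finset.sum_cons, ← ih]
      exact Polynomial.sum_add_index _ _ _ (by simp) (by intros; rw [add_mul])
  rw [reversePoly, Polynomial.sum_def, h, evalL, Polynomial.sum_def, star_sum, Finset.sum_mul]
  refine Finset.sum_congr rfl fun k hk => ?_
  have hk' := Polynomial.le_natDegree_of_mem_supp k hk
  rw [evalR, Polynomial.sum_monomial_index _ _ (by simp), star_mul, star_pow, star_inv₀, star_star,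
    mul_assoc, inv_pow, pow_sub₀ p hp hk', ((Commute.refl p).pow_pow _ _).inv_right₀.eq]

/-! ### Orthonormal polynomials -/

/-- The form `⟨φ, ψ⟩_L = ∑ φ_k c_{k-l} conj ψ_l`, for polynomials with coefficients on the left. -/
def innerL (c : ℤ → ℍ[ℝ]) (φ ψ : ℍ[ℝ][X]) : ℍ[ℝ] :=
  φ.sum fun k a => ψ.sum fun l b => a * c ((k : ℤ) - l) * star b

/-- The form `⟨φ, ψ⟩_R = ∑ conj ψ_l c_{k-l} φ_k`, for polynomials with coefficients on the
right. -/
def innerR (c : ℤ → ℍ[ℝ]) (φ ψ : ℍ[ℝ][X]) : ℍ[ℝ] :=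
  φ.sum fun k a => ψ.sum fun l b => star b * c ((k : ℤ) - l) * a

/-- `φ` divided by its norm in the form `⟨·, ·⟩_L`. -/
def normalizeL (c : ℤ → ℍ[ℝ]) (φ : ℍ[ℝ][X]) : ℍ[ℝ][X] :=
  (√(innerL c φ φ).re)⁻¹ • φ

/-- `φ` divided by its norm in the form `⟨·, ·⟩_R`. -/
def normalizeR (c : ℤ → ℍ[ℝ]) (φ : ℍ[ℝ][X]) : ℍ[ℝ][X] :=
  (√(innerR c φ φ).re)⁻¹ • φ

/-- The left-orthonormal polynomials: the Gram-Schmidt algorithm for `1, p, p², …` with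
coefficients on the left, with respect to `⟨·, ·⟩_L`. -/
def psiL (c : ℤ → ℍ[ℝ]) (n : ℕ) : ℍ[ℝ][X] :=
  normalizeL c (Polynomial.X ^ n - ∑ k : Fin n,
    Polynomial.C (innerL c (Polynomial.X ^ n) (psiL c k)) * psiL c k)
termination_by n
decreasing_by all_goals exact k.2

/-- The right-orthonormal polynomials: the Gram-Schmidt algorithm for `1, p, p², …` with
coefficients on the right, with respect to `⟨·, ·⟩_R`. -/
def psiR (c : ℤ → ℍ[ℝ]) (n : ℕ) : ℍ[ℝ][X] :=
  normalizeR c (Polynomial.X ^ n - ∑ k : Fin n,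
    psiR c k * Polynomial.C (innerR c (Polynomial.X ^ n) (psiR c k)))
termination_by n
decreasing_by all_goals exact k.2

/-! ### Verblunsky coefficients

A left-slice hyperholomorphic function `∑ p^k a_k` near the origin is recorded by the formal power
series of its coefficients; multiplication of power series is the `⋆`-product (convolution of
coefficients), and `Ring.inverse` is the `⋆`-inverse. -/

/-- The function `F(p) = 1 + 2 ∑_{k ≥ 1} p^k c_{-k}`; on the disc of `ℝ + ℝ i` it is the Herglotz
function `∫ (1 + z e^{-iθ}) (1 - z e^{-iθ})⁻¹ dμ(θ)` of a measure `μ` with moments `c`, `c_0 = 1`. -/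
def herglotz (c : ℤ → ℍ[ℝ]) : PowerSeries ℍ[ℝ] :=
  PowerSeries.mk fun k => if k = 0 then 1 else 2 * c (-(k : ℤ))

/-- `p⁻¹ (g(p) - g(0))`. -/
def backwardShift (g : PowerSeries ℍ[ℝ]) : PowerSeries ℍ[ℝ] :=
  PowerSeries.mk fun k => PowerSeries.coeff (k + 1) g

/-- The Schur function `f` of `c`: `p f = (F - 1) ⋆ (F + 1)^{-⋆}`, that is,
`F = (1 + p f) ⋆ (1 - p f)^{-⋆}`. -/
def schurFunction (c : ℤ → ℍ[ℝ]) : PowerSeries ℍ[ℝ] :=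
  backwardShift ((herglotz c - 1) * Ring.inverse (herglotz c + 1))

/-- One step of the Schur algorithm:
`f ↦ p⁻¹ (f - f(0)) ⋆ (1 - conj f(0) ⋆ f)^{-⋆}`. -/
def schurStep (f : PowerSeries ℍ[ℝ]) : PowerSeries ℍ[ℝ] :=
  backwardShift ((f - PowerSeries.C (PowerSeries.constantCoeff f)) *
    Ring.inverse (1 - PowerSeries.C (star (PowerSeries.constantCoeff f)) * f))

/-- The `n`-th Verblunsky coefficient `γ_n = f_n(0)`, where `f_0 = f` and `f_{n+1}` is obtained
from `f_n` by one step of the Schur algorithm. -/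
def verblunsky (c : ℤ → ℍ[ℝ]) (n : ℕ) : ℍ[ℝ] :=
  PowerSeries.constantCoeff (schurStep^[n] (schurFunction c))

/-- The defect `r_n = √(1 - |γ_n|²)`. -/
def defect (c : ℤ → ℍ[ℝ]) (n : ℕ) : ℝ := √(1 - ‖verblunsky c n‖ ^ 2)

end QuatOPUC

end

/-!
The proof linearizes the Schur algorithm. Polynomials and power series have quaternionic
coefficients and a central variable; whether a coefficient stands on the left or on the right
matters only for evaluation and for the two forms, so the four recursions are identities between
polynomials.

Write `T_s(φ) = ∑ φ_k c_{k-s} = ⟨φ, p^s⟩_L` for `s ∈ ℤ` (`toepL`). This functional is left-linear,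
and `T_s(p φ) = T_{s-1}(φ)`. Let the polynomials `A_n`, `B_n` (`szego`) be given by
`A_0 = B_0 = 1` and `A_{n+1} = p A_n - conj γ_n B_n`, `B_{n+1} = B_n - γ_n p A_n`, where `γ_n` are
the coefficients produced by the Schur algorithm. The power series `y_n = ∑ T_{n+k}(A_n) p^k` and
`x_n = ∑ T_{n+1+k}(B_n) p^k` (functions of the second kind) then satisfy
`y_{n+1} = y_n - conj γ_n x_n` and `p x_{n+1} = x_n - γ_n y_n`. This is one step of the Schur
algorithm for the quotient `x_n y_n⁻¹` (`schurStep_mul`), and `x_0 y_0⁻¹` is the Schur function of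
`c`; so `f_n = x_n y_n⁻¹` for all `n`. Reading off the value at the origin,
`γ_n T_n(A_n) = T_{n+1}(B_n)`. Together with hermitian symmetry of the form
(`SzegoState.toepL_neg_one`) this says precisely that one more step of the recursion preserves the
orthogonality relations `T_s(A_n) = 0` for `0 ≤ s < n` and `T_s(B_n) = 0` for `0 < s ≤ n`. The
induction is carried out in `szegoState`. It also shows
`T_n(A_n) = T_0(B_n) = ∏_{k < n} (1 - |γ_k|²)`, and since this is the value of a positive definite
form, `|γ_n| < 1`.

A monic family with these orthogonality relations is the Gram-Schmidt family up to normalization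
(`psiL_eq_smul`). Hence `ψ_n^L` is a real multiple of `A_n`. Conjugation of the coefficients
exchanges the two forms (`psiR_eq_conjPoly`), and so the reverse of `ψ_n^R` is the same real
multiple of `B_n`. The recursions for `ψ_n^L` and for the reverse of `ψ_n^R` follow; the other two
are their reverses.
-/

noncomputable section

namespace QuatOPUC

open Polynomial

/-! ### The Toeplitz functionals -/

/-- The left-linear functional `φ ↦ ∑ φ_k c_{k-s}`, that is, `φ ↦ ⟨φ, p^s⟩_L`; the exponent `s` is
allowed to be any integer. -/
def toepL (c : ℤ → ℍ[ℝ]) (s : ℤ) : ℍ[ℝ][X] →ₗ[ℍ[ℝ]] ℍ[ℝ] :=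
  lsum fun k => LinearMap.toSpanSingleton ℍ[ℝ] ℍ[ℝ] (c (k - s))

theorem toepL_apply (c : ℤ → ℍ[ℝ]) (s : ℤ) (φ : ℍ[ℝ][X]) :
    toepL c s φ = φ.sum fun k a => a * c (k - s) := rfl

theorem toepL_eq_sum_range (c : ℤ → ℍ[ℝ]) (s : ℤ) {n : ℕ} {φ : ℍ[ℝ][X]} (hφ : φ.natDegree ≤ n) :
    toepL c s φ = ∑ k ∈ Finset.range (n + 1), φ.coeff k * c (k - s) :=
  sum_over_range' _ (by simp) (n + 1) (Nat.lt_succ_of_le hφ)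

@[simp]
theorem toepL_monomial (c : ℤ → ℍ[ℝ]) (s : ℤ) (k : ℕ) (a : ℍ[ℝ]) :
    toepL c s (monomial k a) = a * c (k - s) := by
  rw [toepL_apply, sum_monomial_index _ _ (by simp)]

@[simp]
theorem toepL_one (c : ℤ → ℍ[ℝ]) (s : ℤ) : toepL c s 1 = c (-s) := by
  rw [← monomial_zero_one, toepL_monomial]; simp

@[simp]
theorem toepL_real_smul (c : ℤ → ℍ[ℝ]) (s : ℤ) (r : ℝ) (φ : ℍ[ℝ][X]) :
    toepL c s (r • φ) = r • toepL c s φ := by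
  have h : r • φ = (r : ℍ[ℝ]) • φ := by ext1 k; simp [Quaternion.coe_mul_eq_smul]
  rw [h, map_smul, smul_eq_mul, Quaternion.coe_mul_eq_smul]

@[simp]
theorem toepL_X_mul (c : ℤ → ℍ[ℝ]) (s : ℤ) (φ : ℍ[ℝ][X]) :
    toepL c s (X * φ) = toepL c (s - 1) φ := by
  induction φ using Polynomial.induction_on' with
  | add p q hp hq => rw [mul_add, map_add, map_add, hp, hq]
  | monomial k a =>
    rw [X_mul_monomial, toepL_monomial, toepL_monomial]
    congr 2; push_cast; ring

/-- The functionals of the reversed sequence are those of the sequence itself, applied to the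
reflected polynomial. -/
theorem toepL_reflect (c : ℤ → ℍ[ℝ]) (s : ℤ) {n : ℕ} {φ : ℍ[ℝ][X]} (hφ : φ.natDegree ≤ n) :
    toepL (fun m => c (-m)) s (reflect n φ) = toepL c (n - s) φ := by
  rw [toepL_eq_sum_range _ _ (natDegree_reflect_le.trans (max_le le_rfl hφ)),
    toepL_eq_sum_range _ _ hφ, ← Finset.sum_range_reflect]
  refine Finset.sum_congr rfl fun k hk => ?_
  have hk' : k ≤ n := Nat.lt_succ_iff.1 (Finset.mem_range.1 hk)
  rw [coeff_reflect, revAt_le (by omega)]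
  congr 2
  · omega
  · push_cast [Nat.cast_sub hk', Nat.add_sub_cancel]; ring

theorem innerL_eq_sum_toepL (c : ℤ → ℍ[ℝ]) (φ ψ : ℍ[ℝ][X]) :
    innerL c φ ψ = ψ.sum fun l b => toepL c l φ * star b := by
  simp only [innerL, toepL_apply, Polynomial.sum_def, Finset.sum_mul]
  exact Finset.sum_comm

/-- If the functionals of `φ` vanish at all exponents of `ψ` but one, then a single term of
`⟨φ, ψ⟩_L` remains. -/
theorem innerL_eq_single (c : ℤ → ℍ[ℝ]) {φ ψ : ℍ[ℝ][X]} (m : ℕ)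
    (h : ∀ l : ℕ, l ≠ m → ψ.coeff l ≠ 0 → toepL c l φ = 0) :
    innerL c φ ψ = toepL c m φ * star (ψ.coeff m) := by
  rw [innerL_eq_sum_toepL, Polynomial.sum_def]
  refine Finset.sum_eq_single m (fun l hl hlm => ?_) fun hm => ?_
  · rw [h l hlm (mem_support_iff.1 hl), zero_mul]
  · rw [notMem_support_iff.1 hm, star_zero, mul_zero]

theorem star_innerL {c : ℤ → ℍ[ℝ]} (hc : ∀ m, c (-m) = star (c m)) (φ ψ : ℍ[ℝ][X]) :
    star (innerL c φ ψ) = innerL c ψ φ := by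
  simp only [innerL, Polynomial.sum_def, star_sum, star_mul, star_star, ← hc, neg_sub, mul_assoc]
  exact Finset.sum_comm

theorem innerL_sub_left (c : ℤ → ℍ[ℝ]) (φ χ ψ : ℍ[ℝ][X]) :
    innerL c (φ - χ) ψ = innerL c φ ψ - innerL c χ ψ := by
  simp only [innerL_eq_sum_toepL, Polynomial.sum_def, map_sub, sub_mul, Finset.sum_sub_distrib]

theorem innerL_sum_left {ι : Type*} (c : ℤ → ℍ[ℝ]) (s : Finset ι) (φ : ι → ℍ[ℝ][X])
    (ψ : ℍ[ℝ][X]) : innerL c (∑ k ∈ s, φ k) ψ = ∑ k ∈ s, innerL c (φ k) ψ := by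
  simp only [innerL_eq_sum_toepL, Polynomial.sum_def, map_sum, Finset.sum_mul]
  exact Finset.sum_comm

theorem innerL_C_mul_left (c : ℤ → ℍ[ℝ]) (a : ℍ[ℝ]) (φ ψ : ℍ[ℝ][X]) :
    innerL c (C a * φ) ψ = a * innerL c φ ψ := by
  simp only [innerL_eq_sum_toepL, Polynomial.sum_def, ← smul_eq_C_mul, map_smul, smul_eq_mul,
    mul_assoc, Finset.mul_sum]

theorem innerL_real_smul_left (c : ℤ → ℍ[ℝ]) (r : ℝ) (φ ψ : ℍ[ℝ][X]) :
    innerL c (r • φ) ψ = r • innerL c φ ψ := by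
  simp only [innerL_eq_sum_toepL, Polynomial.sum_def, toepL_real_smul, smul_mul_assoc,
    Finset.smul_sum]

theorem innerL_real_smul_right {c : ℤ → ℍ[ℝ]} (hc : ∀ m, c (-m) = star (c m)) (r : ℝ)
    (φ ψ : ℍ[ℝ][X]) : innerL c φ (r • ψ) = r • innerL c φ ψ := by
  rw [← star_innerL hc, innerL_real_smul_left, Quaternion.star_smul, star_innerL hc]

/-! ### Consequences of positive definiteness -/

theorem IsNontrivialPosDef.neg_eq_star {c : ℤ → ℍ[ℝ]} (hc : IsNontrivialPosDef c)
    (h0 : c 0 = 1) (m : ℤ) : c (-m) = star (c m) := by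
  -- it suffices to treat natural numbers
  suffices h : ∀ n : ℕ, c (-(n : ℤ)) = star (c n) by
    obtain ⟨n, rfl | rfl⟩ := m.eq_nat_or_neg
    · exact h n
    · rw [neg_neg, h, star_star]
  rintro (_ | n)
  · simp [h0]
  -- test vectors supported at the two ends of the index range
  have key : ∀ y : ℍ[ℝ], (c (n + 1 : ℕ) * y + star y * c (-((n + 1 : ℕ) : ℤ)) + star y * y).im
      = 0 := by
    intro y
    let ξ : Fin (n + 2) → ℍ[ℝ] := Fin.cons 1 (Fin.snoc 0 y)
    have hξ : ξ ≠ 0 := fun h => one_ne_zero (congrFun h 0)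
    have h := (hc (n + 1) ξ hξ).1
    have e0 : ξ 0 = 1 := rfl
    have e1 : ξ (Fin.last n).succ = y := by simp [ξ]
    have e2 : ∀ k : Fin n, ξ k.castSucc.succ = 0 := by intro k; simp [ξ]
    simp only [dotProduct, Matrix.mulVec, Fin.sum_univ_succ (n := n + 1),
      Fin.sum_univ_castSucc (n := n), toeplitz, Matrix.of_apply, Pi.star_apply, e0, e1, e2] at h
    simp [h0] at h
    simpa [mul_add, add_assoc] using h
  have h1 := key 1
  obtain ⟨u, u0, u1, u2, u3⟩ : ∃ u : ℍ[ℝ], u.re = 0 ∧ u.imI = 1 ∧ u.imJ = 0 ∧ u.imK = 0 :=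
    ⟨⟨0, 1, 0, 0⟩, rfl, rfl, rfl, rfl⟩
  have h2 := key u
  simp [Quaternion.ext_iff, u0, u1, u2, u3] at h1 h2 ⊢
  refine ⟨?_, ?_, ?_, ?_⟩ <;> linarith [h1.1, h1.2.1, h1.2.2, h2.1, h2.2.1, h2.2.2]

theorem IsNontrivialPosDef.innerL_self_pos {c : ℤ → ℍ[ℝ]} (hc : IsNontrivialPosDef c)
    {φ : ℍ[ℝ][X]} (hφ : φ ≠ 0) : 0 < (innerL c φ φ).re := by
  -- conjugating and reversing the coefficients turns the form into that of the Toeplitz matrix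
  set n := φ.natDegree with hn
  let ξ : Fin (n + 1) → ℍ[ℝ] := fun k => star (φ.coeff (n - k))
  have hξ : ξ ≠ 0 := fun h => hφ <| by
    have := congrFun h 0
    simpa [ξ, hn] using this
  have h := (hc n ξ hξ).2
  convert h using 2
  rw [innerL_eq_sum_toepL,
    sum_over_range' φ (f := fun l b => toepL c l φ * star b) (by simp) (n + 1) (Nat.lt_succ_self _),
    ← Finset.sum_range_reflect]
  have hT : ∀ s : ℤ, toepL c s φ =
      ∑ k ∈ Finset.range (n + 1), φ.coeff (n - k) * c ((n - k : ℕ) - s) := fun s => by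
    rw [toepL_eq_sum_range c s hn.ge, ← Finset.sum_range_reflect, Nat.add_sub_cancel]
  simp only [hT, Nat.add_sub_cancel, Finset.sum_mul]
  rw [Finset.sum_comm]
  simp only [dotProduct, Matrix.mulVec, Finset.mul_sum, Finset.sum_range, toeplitz,
    Matrix.of_apply, Pi.star_apply, ξ, star_star]
  refine congrArg _ (Finset.sum_congr rfl fun k _ => Finset.sum_congr rfl fun l _ => ?_)
  have hk := k.2
  have hl := l.2
  rw [mul_assoc]
  congr 3
  omega

/-! ### Uniqueness in the Gram-Schmidt algorithm -/

/-- A family of monic polynomials, one in each degree, whose functionals vanish below the degree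
and whose norms are real, is the Gram-Schmidt family up to normalization. -/
theorem psiL_eq_smul {c : ℤ → ℍ[ℝ]} (hc : ∀ m, c (-m) = star (c m)) {A : ℕ → ℍ[ℝ][X]}
    {N : ℕ → ℝ} (hN : ∀ n, 0 < N n) (hdeg : ∀ n, (A n).natDegree ≤ n)
    (hmonic : ∀ n, (A n).coeff n = 1) (horth : ∀ n l : ℕ, l < n → toepL c l (A n) = 0)
    (hnorm : ∀ n : ℕ, toepL c n (A n) = (N n : ℍ[ℝ])) (n : ℕ) :
    psiL c n = (√(N n))⁻¹ • A n := by
  have hlt : ∀ n (ψ : ℍ[ℝ][X]), ψ.natDegree ≤ n → innerL c (A n) ψ = N n * star (ψ.coeff n) := by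
    intro n ψ hψ
    rw [innerL_eq_single c n, hnorm]
    exact fun l hl hl' => horth n l (lt_of_le_of_ne ((le_natDegree_of_ne_zero hl').trans hψ) hl)
  have hself : ∀ n, innerL c (A n) (A n) = N n := fun n => by
    rw [hlt n _ (hdeg n), hmonic, star_one, mul_one]
  have hne : ∀ k m, k ≠ m → innerL c (A k) (A m) = 0 := by
    have h : ∀ k m, m < k → innerL c (A k) (A m) = 0 := fun k m hkm => by
      rw [hlt k _ ((hdeg m).trans hkm.le), coeff_eq_zero_of_natDegree_lt ((hdeg m).trans_lt hkm),
        star_zero, mul_zero]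
    intro k m hkm
    rcases hkm.lt_or_gt with hkm | hkm
    · rw [← star_innerL hc, h m k hkm, star_zero]
    · exact h k m hkm
  have hsq : ∀ n, (√(N n))⁻¹ * ((√(N n))⁻¹ * N n) = 1 := fun n => by
    have := (Real.sqrt_pos.2 (hN n)).ne'
    nth_rw 3 [← Real.mul_self_sqrt (hN n).le]
    field_simp
  induction n using Nat.strong_induction_on with
  | _ n ih =>
  set φ : ℍ[ℝ][X] := X ^ n - ∑ k : Fin n, C (innerL c (X ^ n) (psiL c k)) * psiL c k with hφ
  have hφd : φ - A n = (X ^ n - A n) - ∑ k : Fin n, C (innerL c (X ^ n) (psiL c k)) * psiL c k := by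
    rw [hφ]; abel
  have hφ_coeff : ∀ m, n ≤ m → (φ - A n).coeff m = 0 := by
    intro m hm
    have hk : ∀ k : Fin n, (A k).coeff m = 0 := fun k =>
      coeff_eq_zero_of_natDegree_lt ((hdeg k).trans_lt (k.2.trans_le hm))
    rw [hφd, coeff_sub, finsetSum_coeff, Finset.sum_eq_zero, sub_zero, coeff_sub, coeff_X_pow]
    · rcases hm.eq_or_lt with rfl | hm
      · rw [if_pos rfl, hmonic, sub_self]
      · rw [if_neg hm.ne', coeff_eq_zero_of_natDegree_lt ((hdeg n).trans_lt hm), sub_zero]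
    · intro k _
      rw [coeff_C_mul, ih k k.2, coeff_smul, hk, smul_zero, mul_zero]
  have hφ_orth : ∀ m, m < n → innerL c (φ - A n) (A m) = 0 := by
    intro m hm
    rw [innerL_sub_left, hne n m hm.ne', sub_zero, hφ, innerL_sub_left, innerL_sum_left,
      Finset.sum_eq_single_of_mem ⟨m, hm⟩ (Finset.mem_univ _), innerL_C_mul_left, ih m hm,
      innerL_real_smul_left, innerL_real_smul_right hc, hself, smul_mul_assoc, mul_smul_comm,
      smul_smul, ← Quaternion.coe_commutes, ← Quaternion.coe_mul_eq_smul]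
    · rw [← mul_assoc, ← Quaternion.coe_mul, mul_assoc, hsq, Quaternion.coe_one, one_mul, sub_self]
    · intro k _ hk
      rw [innerL_C_mul_left, ih k k.2, innerL_real_smul_left, hne k m, smul_zero, mul_zero]
      exact fun h => hk (Fin.ext h)
  -- a nonzero polynomial of degree `m < n` has a nonzero inner product with `A m`
  have hφA : φ = A n := by
    by_contra h
    have h0 : φ - A n ≠ 0 := sub_ne_zero.2 h
    have hm : (φ - A n).natDegree < n := by
      by_contra hm
      exact h0 (leadingCoeff_eq_zero.1 (hφ_coeff _ (not_lt.1 hm)))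
    have h1 := hlt _ (φ - A n) le_rfl
    rw [← star_innerL hc, hφ_orth _ hm, star_zero, eq_comm, mul_eq_zero] at h1
    rcases h1 with h1 | h1
    · exact (hN _).ne' (Quaternion.coe_injective (h1.trans Quaternion.coe_zero.symm))
    · exact h0 (leadingCoeff_eq_zero.1 (star_eq_zero.1 h1))
  rw [psiL, ← hφ, hφA, normalizeL, hself, Quaternion.re_coe]

/-! ### Conjugation of coefficients -/

/-- The polynomial with conjugated coefficients. This is an anti-automorphism. -/
def conjPoly (φ : ℍ[ℝ][X]) : ℍ[ℝ][X] := φ.sum fun k a => monomial k (star a)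

@[simp]
theorem coeff_conjPoly (φ : ℍ[ℝ][X]) (k : ℕ) : (conjPoly φ).coeff k = star (φ.coeff k) := by
  simp only [conjPoly, Polynomial.sum_def, finsetSum_coeff, coeff_monomial, Finset.sum_ite_eq',
    mem_support_iff]
  by_cases h : φ.coeff k = 0 <;> simp [h]

theorem natDegree_conjPoly (φ : ℍ[ℝ][X]) : (conjPoly φ).natDegree = φ.natDegree := by
  have h : (conjPoly φ).support = φ.support := by ext k; simp
  simp only [natDegree, degree, h]

theorem innerR_conjPoly (c : ℤ → ℍ[ℝ]) (φ ψ : ℍ[ℝ][X]) :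
    innerR c (conjPoly φ) (conjPoly ψ) = star (innerL (fun m => star (c m)) φ ψ) := by
  have h : ∀ χ : ℍ[ℝ][X], (conjPoly χ).support = χ.support := fun χ => by ext k; simp
  simp [innerR, innerL, Polynomial.sum_def, h, mul_assoc]

/-- Conjugation of coefficients turns the right-orthonormal polynomials of `c` into the
left-orthonormal polynomials of the conjugate sequence. -/
theorem psiR_eq_conjPoly (c : ℤ → ℍ[ℝ]) (n : ℕ) :
    psiR c n = conjPoly (psiL (fun m => star (c m)) n) := by
  induction n using Nat.strong_induction_on with
  | _ n ih =>
  have hX : (X : ℍ[ℝ][X]) ^ n = conjPoly (X ^ n) := by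
    ext1 k; simp only [coeff_conjPoly, coeff_X_pow]; split_ifs <;> simp
  have h : X ^ n - ∑ k : Fin n, psiR c k * C (innerR c (X ^ n) (psiR c k)) =
      conjPoly (X ^ n - ∑ k : Fin n, C (innerL (fun m => star (c m)) (X ^ n)
        (psiL (fun m => star (c m)) k)) * psiL (fun m => star (c m)) k) := by
    ext1 m
    simp only [coeff_conjPoly, coeff_sub, finsetSum_coeff, star_sub, star_sum, coeff_C_mul,
      coeff_mul_C, star_mul]
    congr 1
    · simp only [coeff_X_pow]; split_ifs <;> simp
    · refine Finset.sum_congr rfl fun k _ => ?_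
      rw [ih k k.2, ← innerR_conjPoly, ← hX, coeff_conjPoly]
  rw [psiR, psiL, h, normalizeR, normalizeL, innerR_conjPoly, Quaternion.re_star]
  ext1 k
  simp

/-- The reverse of a polynomial of degree `n` is its conjugate reflected at `n`. -/
theorem reversePoly_eq (φ : ℍ[ℝ][X]) {n : ℕ} (hφ : φ.natDegree = n) :
    reversePoly φ = reflect n (conjPoly φ) := by
  ext1 k
  rw [reversePoly, hφ, sum_over_range' _ (by simp) (n + 1) (by omega), finsetSum_coeff,
    coeff_reflect, coeff_conjPoly]
  simp only [coeff_monomial]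
  by_cases hk : k ≤ n
  · rw [Finset.sum_eq_single_of_mem (n - k) (by simp), if_pos (by omega), revAt_le hk]
    intro l hl hlk
    rw [Finset.mem_range] at hl
    rw [if_neg (by omega)]
  · rw [revAt_eq_self_of_lt (by omega), coeff_eq_zero_of_natDegree_lt (by omega), star_zero]
    exact Finset.sum_eq_zero fun l _ => if_neg (by omega)

/-! ### The Schur algorithm on quotients of power series -/

theorem X_mul_backwardShift {g : PowerSeries ℍ[ℝ]} (hg : PowerSeries.constantCoeff g = 0) :
    PowerSeries.X * backwardShift g = g := by
  ext1 k
  cases k with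
  | zero => simp [hg]
  | succ k => rw [PowerSeries.coeff_succ_X_mul, backwardShift, PowerSeries.coeff_mk]

theorem isUnit_of_constantCoeff_ne_zero {g : PowerSeries ℍ[ℝ]}
    (hg : PowerSeries.constantCoeff g ≠ 0) : IsUnit g :=
  PowerSeries.isUnit_iff_constantCoeff.2 hg.isUnit

/-- A quotient `p⁻¹ (g ⋆ h⁻¹)` is characterized by clearing denominators. -/
theorem backwardShift_mul_inverse_mul {g h x z : PowerSeries ℍ[ℝ]} (hh : IsUnit h)
    (hg : PowerSeries.constantCoeff g = 0) (hx : g * z = PowerSeries.X * x) :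
    backwardShift (g * Ring.inverse h) * (h * z) = x := by
  apply PowerSeries.X_mul_cancel
  rw [← mul_assoc, X_mul_backwardShift (by simp [hg]), mul_assoc,
    Ring.inverse_mul_cancel_left _ _ hh, hx]

/-- If `f = x y⁻¹`, then one step of the Schur algorithm leads to the quotient of
`p⁻¹ (x - γ y)` and `y - conj γ x`, where `γ = f(0)`. -/
theorem schurStep_mul {f x y x' : PowerSeries ℍ[ℝ]} (hf : f * y = x)
    (hγ : ‖PowerSeries.constantCoeff f‖ < 1)
    (hx' : PowerSeries.X * x' = x - PowerSeries.C (PowerSeries.constantCoeff f) * y) :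
    schurStep f * (y - PowerSeries.C (star (PowerSeries.constantCoeff f)) * x) = x' := by
  have h : IsUnit (1 - PowerSeries.C (star (PowerSeries.constantCoeff f)) * f) := by
    apply isUnit_of_constantCoeff_ne_zero
    intro h
    rw [map_sub, map_one, map_mul, PowerSeries.constantCoeff_C, Quaternion.star_mul_self,
      sub_eq_zero, ← Quaternion.coe_one, Quaternion.coe_inj, Quaternion.normSq_eq_norm_mul_self]
      at h
    nlinarith [norm_nonneg (PowerSeries.constantCoeff f)]
  have e : y - PowerSeries.C (star (PowerSeries.constantCoeff f)) * x =
      (1 - PowerSeries.C (star (PowerSeries.constantCoeff f)) * f) * y := by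
    rw [sub_mul, one_mul, mul_assoc, hf]
  rw [e]
  exact backwardShift_mul_inverse_mul h (by simp) (by rw [hx', sub_mul, hf])

/-! ### The monic Szegő recursion -/

/-- The monic Szegő recursion with parameters `γ`, for coefficients on the left. The first
component is the monic orthogonal polynomial `A_n`, the second one `B_n` is the reverse of the monic
right-orthogonal polynomial. -/
def szego (γ : ℕ → ℍ[ℝ]) : ℕ → ℍ[ℝ][X] × ℍ[ℝ][X]
  | 0 => (1, 1)
  | n + 1 => (X * (szego γ n).1 - star (γ n) • (szego γ n).2,
      (szego γ n).2 - γ n • (X * (szego γ n).1))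

section Degree

variable (γ : ℕ → ℍ[ℝ]) (n : ℕ)

theorem natDegree_szego : (szego γ n).1.natDegree ≤ n ∧ (szego γ n).2.natDegree ≤ n := by
  induction n with
  | zero => simp [szego]
  | succ n ih =>
    have h : (X * (szego γ n).1).natDegree ≤ n + 1 :=
      natDegree_mul_le.trans (by rw [natDegree_X]; omega)
    simp only [szego]
    constructor
    · refine (natDegree_sub_le _ _).trans (max_le h ((natDegree_smul_le _ _).trans ?_))
      exact ih.2.trans n.le_succ
    · refine (natDegree_sub_le _ _).trans (max_le ?_ ((natDegree_smul_le _ _).trans h))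
      exact ih.2.trans n.le_succ

theorem coeff_szego_fst : (szego γ n).1.coeff n = 1 := by
  cases n with
  | zero => simp [szego]
  | succ n =>
    induction n with
    | zero => simp [szego, coeff_one]
    | succ n ih =>
      rw [szego, coeff_sub, coeff_X_mul, ih, coeff_smul,
        coeff_eq_zero_of_natDegree_lt ((natDegree_szego γ _).2.trans_lt (Nat.lt_succ_self _)),
        smul_zero, sub_zero]

theorem coeff_szego_snd : (szego γ n).2.coeff 0 = 1 := by
  induction n with
  | zero => simp [szego]
  | succ n ih => simp [szego, ih]

end Degree

/-! ### Functions of the second kind and the Schur algorithm -/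

/-- The common squared norm of the `n`-th monic orthogonal polynomials. -/
def normSzego (c : ℤ → ℍ[ℝ]) (n : ℕ) : ℝ := ∏ k ∈ Finset.range n, (1 - ‖verblunsky c k‖ ^ 2)

/-- The power series `∑ ⟨A_n, p^{n+k}⟩ p^k`. -/
def secondKindA (c : ℤ → ℍ[ℝ]) (n : ℕ) : PowerSeries ℍ[ℝ] :=
  PowerSeries.mk fun k => toepL c (n + k) (szego (verblunsky c) n).1

/-- The power series `∑ ⟨B_n, p^{n+1+k}⟩ p^k`. -/
def secondKindB (c : ℤ → ℍ[ℝ]) (n : ℕ) : PowerSeries ℍ[ℝ] :=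
  PowerSeries.mk fun k => toepL c (n + 1 + k) (szego (verblunsky c) n).2

theorem secondKindA_succ (c : ℤ → ℍ[ℝ]) (n : ℕ) : secondKindA c (n + 1) =
    secondKindA c n - PowerSeries.C (star (verblunsky c n)) * secondKindB c n := by
  ext1 k
  simp only [secondKindA, secondKindB, szego, map_sub, map_smul, toepL_X_mul, smul_eq_mul,
    PowerSeries.coeff_mk, PowerSeries.coeff_C_mul]
  congr 3
  · push_cast; ring

theorem X_mul_secondKindB_succ {c : ℤ → ℍ[ℝ]} {n : ℕ}
    (h : toepL c (n + 1) (szego (verblunsky c) n).2 =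
      verblunsky c n * toepL c n (szego (verblunsky c) n).1) :
    PowerSeries.X * secondKindB c (n + 1) =
      secondKindB c n - PowerSeries.C (verblunsky c n) * secondKindA c n := by
  ext1 k
  cases k with
  | zero => simp [secondKindA, secondKindB, h]
  | succ k =>
    simp only [secondKindA, secondKindB, szego, map_sub, map_smul, toepL_X_mul, smul_eq_mul,
      PowerSeries.coeff_mk, PowerSeries.coeff_C_mul, PowerSeries.coeff_succ_X_mul]
    congr 1
    · congr 2; push_cast; ring
    · congr 3; push_cast; ring

theorem schurFunction_mul {c : ℤ → ℍ[ℝ]} (h0 : c 0 = 1) :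
    schurFunction c * secondKindA c 0 = secondKindB c 0 := by
  have hA : herglotz c + 1 = secondKindA c 0 * 2 := by
    ext1 k
    rw [mul_two]
    cases k with
    | zero => simp [herglotz, secondKindA, szego, h0, ← one_add_one_eq_two]
    | succ k => simp [herglotz, secondKindA, szego, PowerSeries.coeff_one, two_mul]
  have hB : (herglotz c - 1) * 1 = PowerSeries.X * (secondKindB c 0 * 2) := by
    ext1 k
    rw [mul_two, mul_one]
    cases k with
    | zero => simp [herglotz]
    | succ k =>
      simp [herglotz, secondKindB, szego, PowerSeries.coeff_one, PowerSeries.coeff_succ_X_mul,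
        two_mul, add_comm]
  have two_ne : (2 : ℍ[ℝ]) ≠ 0 := fun h => by
    have h := congrArg (·.re) ((one_add_one_eq_two (R := ℍ[ℝ])).trans h)
    simp only [Quaternion.re_add, Quaternion.re_one, Quaternion.re_zero] at h
    norm_num at h
  have hu : IsUnit (herglotz c + 1) :=
    isUnit_of_constantCoeff_ne_zero (by simpa [herglotz, one_add_one_eq_two])
  have h := backwardShift_mul_inverse_mul hu (by simp [herglotz]) hB
  have h2 : IsUnit (2 : PowerSeries ℍ[ℝ]) := isUnit_of_constantCoeff_ne_zero (by rwa [map_ofNat])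
  rwa [mul_one, hA, ← mul_assoc, h2.mul_left_inj, ← hA] at h

/-- The state of the recursion after `n` steps: `A_n` is orthogonal to `p^s` for `0 ≤ s < n` and
`B_n` for `0 < s ≤ n`, their norms agree, and the `n`-th Schur iterate is the quotient of the
functions of the second kind. -/
structure SzegoState (c : ℤ → ℍ[ℝ]) (n : ℕ) : Prop where
  orthA : ∀ s : ℤ, 0 ≤ s → s < n → toepL c s (szego (verblunsky c) n).1 = 0
  orthB : ∀ s : ℤ, 0 < s → s ≤ n → toepL c s (szego (verblunsky c) n).2 = 0
  normA : toepL c n (szego (verblunsky c) n).1 = (normSzego c n : ℍ[ℝ])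
  normB : toepL c 0 (szego (verblunsky c) n).2 = (normSzego c n : ℍ[ℝ])
  quot : schurStep^[n] (schurFunction c) * secondKindA c n = secondKindB c n

namespace SzegoState

variable {c : ℤ → ℍ[ℝ]} {n : ℕ}

/-- The value at the origin of the Schur iterate, read off from the quotient. -/
theorem toepL_succ (h : SzegoState c n) :
    toepL c (n + 1) (szego (verblunsky c) n).2 = verblunsky c n * (normSzego c n : ℍ[ℝ]) := by
  have hA : PowerSeries.constantCoeff (secondKindA c n) = (normSzego c n : ℍ[ℝ]) := by
    simp [secondKindA, h.normA]
  have hB : PowerSeries.constantCoeff (secondKindB c n) =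
      toepL c (n + 1) (szego (verblunsky c) n).2 := by
    simp [secondKindB]
  rw [← hA, ← hB, ← h.quot, map_mul, verblunsky]

/-- By orthogonality, only the extreme terms remain in `⟨p A_n, B_n⟩` and `⟨B_n, p A_n⟩`, so
hermitian symmetry links the obstructions to orthogonality in degree `n + 1`. -/
theorem toepL_neg_one (h : SzegoState c n) (hc : ∀ m, c (-m) = star (c m)) :
    toepL c (-1) (szego (verblunsky c) n).1 =
      star (verblunsky c n) * (normSzego c n : ℍ[ℝ]) := by
  set A := (szego (verblunsky c) n).1 with hA
  set B := (szego (verblunsky c) n).2 with hB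
  have h1 : innerL c (X * A) B = toepL c (-1) A := by
    rw [innerL_eq_single c 0, hB, coeff_szego_snd, toepL_X_mul]
    · simp
    · intro l hl hl'
      have := (le_natDegree_of_ne_zero hl').trans (natDegree_szego _ _).2
      rw [toepL_X_mul]
      exact h.orthA _ (by omega) (by omega)
  have h2 : innerL c B (X * A) = toepL c (n + 1) B := by
    rw [innerL_eq_single c (n + 1), coeff_X_mul, hA, coeff_szego_fst]
    · simp
    · intro l hl hl'
      obtain _ | l := l
      · simp at hl'
      rw [coeff_X_mul] at hl'
      have := (le_natDegree_of_ne_zero hl').trans (natDegree_szego _ _).1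
      exact h.orthB _ (by omega) (by omega)
  rw [← h1, ← star_innerL hc, h2, h.toepL_succ, star_mul, Quaternion.star_coe,
    Quaternion.coe_commutes]

end SzegoState

theorem normSzego_succ (c : ℤ → ℍ[ℝ]) (n : ℕ) :
    normSzego c (n + 1) = normSzego c n * (1 - ‖verblunsky c n‖ ^ 2) :=
  Finset.prod_range_succ _ _

/-- The norm is the value of a positive definite form at the monic polynomial `A_n`. -/
theorem normSzego_pos_of_orth {c : ℤ → ℍ[ℝ]} {n : ℕ} (hc : IsNontrivialPosDef c)
    (orthA : ∀ s : ℤ, 0 ≤ s → s < n → toepL c s (szego (verblunsky c) n).1 = 0)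
    (normA : toepL c n (szego (verblunsky c) n).1 = (normSzego c n : ℍ[ℝ])) :
    0 < normSzego c n := by
  have h0 : (szego (verblunsky c) n).1 ≠ 0 := fun h0 => by
    simpa [h0] using coeff_szego_fst (verblunsky c) n
  have := hc.innerL_self_pos h0
  rwa [innerL_eq_single c n, coeff_szego_fst, normA, star_one, mul_one, Quaternion.re_coe] at this
  intro l hl hl'
  have := (le_natDegree_of_ne_zero hl').trans (natDegree_szego _ _).1
  exact orthA _ (by omega) (by omega)

theorem norm_verblunsky_lt_one {c : ℤ → ℍ[ℝ]} {n : ℕ} (h : 0 < normSzego c n)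
    (h' : 0 < normSzego c (n + 1)) : ‖verblunsky c n‖ < 1 := by
  rw [normSzego_succ, mul_pos_iff_of_pos_left h] at h'
  nlinarith [norm_nonneg (verblunsky c n)]

theorem szegoState {c : ℤ → ℍ[ℝ]} (hc : IsNontrivialPosDef c) (h0 : c 0 = 1) (n : ℕ) :
    SzegoState c n := by
  have hs := hc.neg_eq_star h0
  induction n with
  | zero =>
    exact ⟨fun s hs hs' => by simp at hs'; omega, fun s hs hs' => by simp at hs'; omega,
      by simp [szego, normSzego, h0], by simp [szego, normSzego, h0], schurFunction_mul h0⟩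
  | succ n ih =>
    have hγB := ih.toepL_succ
    have hγA := ih.toepL_neg_one hs
    have orthA : ∀ s : ℤ, 0 ≤ s → s < (n + 1 : ℕ) →
        toepL c s (szego (verblunsky c) (n + 1)).1 = 0 := by
      intro s hs hs'
      rw [szego, map_sub, map_smul, toepL_X_mul, smul_eq_mul]
      rcases hs.eq_or_lt with rfl | hs
      · rw [zero_sub, hγA, ih.normB, sub_self]
      · rw [ih.orthA _ (by omega) (by omega), ih.orthB _ hs (by omega), mul_zero, sub_zero]
    have normA : toepL c (n + 1 : ℕ) (szego (verblunsky c) (n + 1)).1 =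
        (normSzego c (n + 1) : ℍ[ℝ]) := by
      rw [szego, map_sub, map_smul, toepL_X_mul, smul_eq_mul, Nat.cast_succ, add_sub_cancel_right,
        ih.normA, hγB, ← mul_assoc, Quaternion.star_mul_self, normSzego_succ,
        Quaternion.normSq_eq_norm_mul_self]
      push_cast
      rw [mul_sub, mul_one, sq, ← Quaternion.coe_mul, ← Quaternion.coe_mul, ← Quaternion.coe_mul,
        mul_comm (normSzego c n)]
    -- positivity of the next norm forces `|γ_n| < 1`, which makes the next step of the Schur
    -- algorithm a genuine division
    have hγ := norm_verblunsky_lt_one (normSzego_pos_of_orth hc ih.orthA ih.normA)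
      (normSzego_pos_of_orth hc orthA normA)
    refine ⟨orthA, ?_, normA, ?_, ?_⟩
    · intro s hs hs'
      rw [szego, map_sub, map_smul, toepL_X_mul, smul_eq_mul]
      rcases hs'.eq_or_lt with rfl | hs'
      · rw [Nat.cast_succ, add_sub_cancel_right, ih.normA, hγB, sub_self]
      · rw [ih.orthA _ (by omega) (by omega), ih.orthB _ hs (by omega), mul_zero, sub_zero]
    · rw [szego, map_sub, map_smul, toepL_X_mul, smul_eq_mul, zero_sub, hγA, ih.normB,
        ← mul_assoc, Quaternion.self_mul_star, normSzego_succ, Quaternion.normSq_eq_norm_mul_self]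
      push_cast
      rw [mul_sub, mul_one, sq, ← Quaternion.coe_mul, ← Quaternion.coe_mul, ← Quaternion.coe_mul,
        mul_comm (normSzego c n)]
    · rw [secondKindA_succ, Function.iterate_succ_apply']
      exact schurStep_mul ih.quot hγ (X_mul_secondKindB_succ (by rw [hγB, ih.normA]))

/-! ### The Szegő recursion for the orthonormal polynomials -/

section

variable {c : ℤ → ℍ[ℝ]}

theorem normSzego_pos (hc : IsNontrivialPosDef c) (h0 : c 0 = 1) (n : ℕ) : 0 < normSzego c n :=
  normSzego_pos_of_orth hc (szegoState hc h0 n).orthA (szegoState hc h0 n).normA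

theorem psiL_eq_szego (hc : IsNontrivialPosDef c) (h0 : c 0 = 1) (n : ℕ) :
    psiL c n = (√(normSzego c n))⁻¹ • (szego (verblunsky c) n).1 :=
  psiL_eq_smul (hc.neg_eq_star h0) (normSzego_pos hc h0) (fun n => (natDegree_szego _ n).1)
    (coeff_szego_fst _) (fun n l hl => (szegoState hc h0 n).orthA l (by omega) (by omega))
    (fun n => (szegoState hc h0 n).normA) n

theorem psiR_eq_szego (hc : IsNontrivialPosDef c) (h0 : c 0 = 1) (n : ℕ) :
    psiR c n = (√(normSzego c n))⁻¹ • conjPoly (reflect n (szego (verblunsky c) n).2) := by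
  have hs := hc.neg_eq_star h0
  have hs' : (fun m => star (c m)) = fun m => c (-m) := funext fun m => (hs m).symm
  have hB := fun n => (natDegree_szego (verblunsky c) n).2
  rw [psiR_eq_conjPoly, hs', psiL_eq_smul (c := fun m => c (-m)) (N := normSzego c)
    (A := fun n => reflect n (szego (verblunsky c) n).2) (fun m => hs (-m)) (normSzego_pos hc h0)
    (fun n => natDegree_reflect_le.trans (max_le le_rfl (hB n)))]
  · ext1 k; simp
  · intro n
    rw [coeff_reflect, revAt_le le_rfl, Nat.sub_self, coeff_szego_snd]
  · intro n l hl
    rw [toepL_reflect c l (hB n)]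
    exact (szegoState hc h0 n).orthB _ (by omega) (by omega)
  · intro n
    rw [toepL_reflect c n (hB n), sub_self]
    exact (szegoState hc h0 n).normB

theorem natDegree_eq_of_coeff {φ : ℍ[ℝ][X]} {n : ℕ} (h : φ.natDegree ≤ n) (h' : φ.coeff n ≠ 0) :
    φ.natDegree = n :=
  le_antisymm h (le_natDegree_of_ne_zero h')

theorem natDegree_psiL (hc : IsNontrivialPosDef c) (h0 : c 0 = 1) (n : ℕ) :
    (psiL c n).natDegree = n := by
  have hN := (Real.sqrt_pos.2 (normSzego_pos hc h0 n)).ne'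
  rw [psiL_eq_szego hc h0]
  apply natDegree_eq_of_coeff ((natDegree_smul_le _ _).trans (natDegree_szego _ n).1)
  rw [coeff_smul, coeff_szego_fst]
  exact smul_ne_zero (inv_ne_zero hN) one_ne_zero

theorem natDegree_psiR (hc : IsNontrivialPosDef c) (h0 : c 0 = 1) (n : ℕ) :
    (psiR c n).natDegree = n := by
  have hN := (Real.sqrt_pos.2 (normSzego_pos hc h0 n)).ne'
  rw [psiR_eq_szego hc h0]
  apply natDegree_eq_of_coeff ((natDegree_smul_le _ _).trans ?_)
  · rw [coeff_smul, coeff_conjPoly, coeff_reflect, revAt_le le_rfl, Nat.sub_self, coeff_szego_snd,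
      star_one]
    exact smul_ne_zero (inv_ne_zero hN) one_ne_zero
  · rw [natDegree_conjPoly]
    exact natDegree_reflect_le.trans (max_le le_rfl (natDegree_szego _ n).2)

theorem reversePoly_psiR (hc : IsNontrivialPosDef c) (h0 : c 0 = 1) (n : ℕ) :
    reversePoly (psiR c n) = (√(normSzego c n))⁻¹ • (szego (verblunsky c) n).2 := by
  rw [reversePoly_eq _ (natDegree_psiR hc h0 n), psiR_eq_szego hc h0]
  ext1 k
  simp [coeff_reflect]

theorem sqrt_normSzego_succ (hc : IsNontrivialPosDef c) (h0 : c 0 = 1) (n : ℕ) :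
    (√(normSzego c (n + 1)))⁻¹ = (defect c n)⁻¹ * (√(normSzego c n))⁻¹ := by
  rw [normSzego_succ, Real.sqrt_mul (normSzego_pos hc h0 n).le, mul_inv, mul_comm, defect]

theorem psiL_succ (hc : IsNontrivialPosDef c) (h0 : c 0 = 1) (n : ℕ) :
    psiL c (n + 1) = (defect c n)⁻¹ •
      (X * psiL c n - C (star (verblunsky c n)) * reversePoly (psiR c n)) := by
  rw [psiL_eq_szego hc h0, psiL_eq_szego hc h0, reversePoly_psiR hc h0, szego,
    sqrt_normSzego_succ hc h0, mul_smul, smul_sub _ (X * _), ← smul_eq_C_mul, mul_smul_comm,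
    smul_comm (star _)]

theorem reversePoly_psiR_succ (hc : IsNontrivialPosDef c) (h0 : c 0 = 1) (n : ℕ) :
    reversePoly (psiR c (n + 1)) = (defect c n)⁻¹ •
      (reversePoly (psiR c n) - C (verblunsky c n) * (X * psiL c n)) := by
  rw [reversePoly_psiR hc h0, reversePoly_psiR hc h0, psiL_eq_szego hc h0, szego,
    sqrt_normSzego_succ hc h0, mul_smul, smul_sub _ (szego _ _).2, ← smul_eq_C_mul, mul_smul_comm,
    smul_comm (verblunsky c n)]

theorem reflect_succ_X_mul {φ : ℍ[ℝ][X]} {n : ℕ} (h : φ.natDegree ≤ n) :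
    reflect (n + 1) (X * φ) = reflect n φ := by
  rw [add_comm, reflect_mul _ _ (natDegree_X_le) h, reflect_one_X, one_mul]

theorem reflect_succ {φ : ℍ[ℝ][X]} {n : ℕ} (h : φ.natDegree ≤ n) :
    reflect (n + 1) φ = X * reflect n φ := by
  conv_lhs => rw [← one_mul φ]
  rw [add_comm, reflect_mul _ _ (by simp) h, reflect_one, pow_one]

theorem natDegree_reversePoly_le {φ : ℍ[ℝ][X]} {n : ℕ} (h : φ.natDegree = n) :
    (reversePoly φ).natDegree ≤ n := by
  rw [reversePoly_eq _ h]
  exact natDegree_reflect_le.trans (by rw [natDegree_conjPoly, h, max_self])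

theorem reflect_conjPoly_reversePoly {φ : ℍ[ℝ][X]} {n : ℕ} (h : φ.natDegree = n) :
    reflect n (conjPoly (reversePoly φ)) = φ := by
  rw [reversePoly_eq _ h]
  ext1 k
  simp [coeff_reflect]

theorem reversePoly_eq_reflect_X_mul {φ : ℍ[ℝ][X]} {n : ℕ} (h : φ.natDegree = n) :
    reversePoly φ = reflect (n + 1) (conjPoly (X * φ)) := by
  have hX : conjPoly (X * φ) = X * conjPoly φ := by ext1 k; cases k <;> simp
  rw [hX, reflect_succ_X_mul (by rw [natDegree_conjPoly, h]), reversePoly_eq _ h]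

theorem X_mul_eq_reflect_reversePoly {φ : ℍ[ℝ][X]} {n : ℕ} (h : φ.natDegree = n) :
    X * φ = reflect (n + 1) (conjPoly (reversePoly φ)) := by
  rw [reflect_succ (by rw [natDegree_conjPoly]; exact natDegree_reversePoly_le h),
    reflect_conjPoly_reversePoly h]

/-- This is the recursion for `ψ_{n+1}^L`, conjugated and reflected at `n + 1`. -/
theorem reversePoly_psiL_succ (hc : IsNontrivialPosDef c) (h0 : c 0 = 1) (n : ℕ) :
    reversePoly (psiL c (n + 1)) = (defect c n)⁻¹ •
      (reversePoly (psiL c n) - X * psiR c n * C (verblunsky c n)) := by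
  rw [reversePoly_eq _ (natDegree_psiL hc h0 (n + 1)),
    reversePoly_eq_reflect_X_mul (natDegree_psiL hc h0 n),
    X_mul_eq_reflect_reversePoly (natDegree_psiR hc h0 n), psiL_succ hc h0]
  ext1 k
  simp [coeff_reflect]

/-- This is the recursion for the reverse of `ψ_{n+1}^R`, conjugated and reflected at `n + 1`. -/
theorem psiR_succ (hc : IsNontrivialPosDef c) (h0 : c 0 = 1) (n : ℕ) :
    psiR c (n + 1) = (defect c n)⁻¹ •
      (X * psiR c n - reversePoly (psiL c n) * C (star (verblunsky c n))) := by
  rw [← reflect_conjPoly_reversePoly (natDegree_psiR hc h0 (n + 1)),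
    reversePoly_eq_reflect_X_mul (natDegree_psiL hc h0 n),
    X_mul_eq_reflect_reversePoly (natDegree_psiR hc h0 n), reversePoly_psiR_succ hc h0]
  ext1 k
  simp [coeff_reflect]

end

/-! ### Evaluation -/

theorem evalR_add (φ ψ : ℍ[ℝ][X]) (p : ℍ[ℝ]) : evalR (φ + ψ) p = evalR φ p + evalR ψ p :=
  sum_add_index _ _ _ (by simp) (by simp [add_mul])

theorem evalL_add (φ ψ : ℍ[ℝ][X]) (p : ℍ[ℝ]) : evalL (φ + ψ) p = evalL φ p + evalL ψ p :=
  sum_add_index _ _ _ (by simp) (by simp [mul_add])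

theorem evalR_sub (φ ψ : ℍ[ℝ][X]) (p : ℍ[ℝ]) : evalR (φ - ψ) p = evalR φ p - evalR ψ p := by
  rw [eq_sub_iff_add_eq, ← evalR_add, sub_add_cancel]

theorem evalL_sub (φ ψ : ℍ[ℝ][X]) (p : ℍ[ℝ]) : evalL (φ - ψ) p = evalL φ p - evalL ψ p := by
  rw [eq_sub_iff_add_eq, ← evalL_add, sub_add_cancel]

@[simp]
theorem evalR_monomial (k : ℕ) (a p : ℍ[ℝ]) : evalR (monomial k a) p = a * p ^ k :=
  sum_monomial_index _ _ (by simp)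

@[simp]
theorem evalL_monomial (k : ℕ) (a p : ℍ[ℝ]) : evalL (monomial k a) p = p ^ k * a :=
  sum_monomial_index _ _ (by simp)

theorem evalR_real_smul (r : ℝ) (φ : ℍ[ℝ][X]) (p : ℍ[ℝ]) : evalR (r • φ) p = r • evalR φ p := by
  induction φ using Polynomial.induction_on' with
  | add φ ψ hφ hψ => rw [smul_add, evalR_add, evalR_add, hφ, hψ, smul_add]
  | monomial k a => rw [smul_monomial, evalR_monomial, evalR_monomial, smul_mul_assoc]

theorem evalL_real_smul (r : ℝ) (φ : ℍ[ℝ][X]) (p : ℍ[ℝ]) : evalL (r • φ) p = r • evalL φ p := by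
  induction φ using Polynomial.induction_on' with
  | add φ ψ hφ hψ => rw [smul_add, evalL_add, evalL_add, hφ, hψ, smul_add]
  | monomial k a => rw [smul_monomial, evalL_monomial, evalL_monomial, mul_smul_comm]

theorem evalR_C_mul (a : ℍ[ℝ]) (φ : ℍ[ℝ][X]) (p : ℍ[ℝ]) : evalR (C a * φ) p = a * evalR φ p := by
  induction φ using Polynomial.induction_on' with
  | add φ ψ hφ hψ => rw [mul_add, evalR_add, evalR_add, hφ, hψ, mul_add]
  | monomial k b => rw [C_mul_monomial, evalR_monomial, evalR_monomial, mul_assoc]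

theorem evalL_mul_C (a : ℍ[ℝ]) (φ : ℍ[ℝ][X]) (p : ℍ[ℝ]) : evalL (φ * C a) p = evalL φ p * a := by
  induction φ using Polynomial.induction_on' with
  | add φ ψ hφ hψ => rw [add_mul, evalL_add, evalL_add, hφ, hψ, add_mul]
  | monomial k b => rw [monomial_mul_C, evalL_monomial, evalL_monomial, mul_assoc]

theorem evalR_X_mul (φ : ℍ[ℝ][X]) (p : ℍ[ℝ]) : evalR (X * φ) p = evalR φ p * p := by
  induction φ using Polynomial.induction_on' with
  | add φ ψ hφ hψ => rw [mul_add, evalR_add, evalR_add, hφ, hψ, add_mul]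
  | monomial k a => rw [X_mul_monomial, evalR_monomial, evalR_monomial, pow_succ, mul_assoc]

theorem evalL_X_mul (φ : ℍ[ℝ][X]) (p : ℍ[ℝ]) : evalL (X * φ) p = p * evalL φ p := by
  induction φ using Polynomial.induction_on' with
  | add φ ψ hφ hψ => rw [mul_add, evalL_add, evalL_add, hφ, hψ, mul_add]
  | monomial k a => rw [X_mul_monomial, evalL_monomial, evalL_monomial, pow_succ', mul_assoc]

end QuatOPUC

end

theorem mainTheorem4 :
    (∀ c : ℤ → Quaternion ℝ, QuatOPUC.IsNontrivialPosDef c → c 0 = 1 →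
      ∀ n : ℕ, ‖QuatOPUC.verblunsky c n‖ < 1 ∧ ∀ p : Quaternion ℝ,
        QuatOPUC.evalR (QuatOPUC.psiL c (n + 1)) p =
          (QuatOPUC.defect c n)⁻¹ • (QuatOPUC.evalR (QuatOPUC.psiL c n) p * p -
            star (QuatOPUC.verblunsky c n) *
              QuatOPUC.evalR (QuatOPUC.reversePoly (QuatOPUC.psiR c n)) p) ∧
        QuatOPUC.evalL (QuatOPUC.reversePoly (QuatOPUC.psiL c (n + 1))) p =
          (QuatOPUC.defect c n)⁻¹ • (QuatOPUC.evalL (QuatOPUC.reversePoly (QuatOPUC.psiL c n)) p -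
            p * QuatOPUC.evalL (QuatOPUC.psiR c n) p * QuatOPUC.verblunsky c n) ∧
        QuatOPUC.evalL (QuatOPUC.psiR c (n + 1)) p =
          (QuatOPUC.defect c n)⁻¹ • (p * QuatOPUC.evalL (QuatOPUC.psiR c n) p -
            QuatOPUC.evalL (QuatOPUC.reversePoly (QuatOPUC.psiL c n)) p *
              star (QuatOPUC.verblunsky c n)) ∧
        QuatOPUC.evalR (QuatOPUC.reversePoly (QuatOPUC.psiR c (n + 1))) p =
          (QuatOPUC.defect c n)⁻¹ • (QuatOPUC.evalR (QuatOPUC.reversePoly (QuatOPUC.psiR c n)) p -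
            QuatOPUC.verblunsky c n * QuatOPUC.evalR (QuatOPUC.psiL c n) p * p)) ∧
    (∀ (i j : Quaternion ℝ) (μ : MeasureTheory.VectorMeasure (QuatOPUC.sliceCircle i) (Quaternion ℝ)),
      i ∈ QuatOPUC.imagSphere → j ∈ QuatOPUC.imagSphere → inner ℝ i j = 0 →
      QuatOPUC.IsQPositive i j μ → QuatOPUC.IsNontrivialMeasure μ → QuatOPUC.moment μ 0 = 1 →
      ∀ n : ℕ, ‖QuatOPUC.verblunsky (QuatOPUC.moment μ) n‖ < 1 ∧ ∀ p : Quaternion ℝ,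
        QuatOPUC.evalR (QuatOPUC.psiL (QuatOPUC.moment μ) (n + 1)) p =
          (QuatOPUC.defect (QuatOPUC.moment μ) n)⁻¹ • (QuatOPUC.evalR (QuatOPUC.psiL (QuatOPUC.moment μ) n) p * p -
            star (QuatOPUC.verblunsky (QuatOPUC.moment μ) n) *
              QuatOPUC.evalR (QuatOPUC.reversePoly (QuatOPUC.psiR (QuatOPUC.moment μ) n)) p) ∧
        QuatOPUC.evalL (QuatOPUC.reversePoly (QuatOPUC.psiL (QuatOPUC.moment μ) (n + 1))) p =
          (QuatOPUC.defect (QuatOPUC.moment μ) n)⁻¹ • (QuatOPUC.evalL (QuatOPUC.reversePoly (QuatOPUC.psiL (QuatOPUC.moment μ) n)) p -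
            p * QuatOPUC.evalL (QuatOPUC.psiR (QuatOPUC.moment μ) n) p * QuatOPUC.verblunsky (QuatOPUC.moment μ) n) ∧
        QuatOPUC.evalL (QuatOPUC.psiR (QuatOPUC.moment μ) (n + 1)) p =
          (QuatOPUC.defect (QuatOPUC.moment μ) n)⁻¹ • (p * QuatOPUC.evalL (QuatOPUC.psiR (QuatOPUC.moment μ) n) p -
            QuatOPUC.evalL (QuatOPUC.reversePoly (QuatOPUC.psiL (QuatOPUC.moment μ) n)) p *
              star (QuatOPUC.verblunsky (QuatOPUC.moment μ) n)) ∧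
        QuatOPUC.evalR (QuatOPUC.reversePoly (QuatOPUC.psiR (QuatOPUC.moment μ) (n + 1))) p =
          (QuatOPUC.defect (QuatOPUC.moment μ) n)⁻¹ • (QuatOPUC.evalR (QuatOPUC.reversePoly (QuatOPUC.psiR (QuatOPUC.moment μ) n)) p -
            QuatOPUC.verblunsky (QuatOPUC.moment μ) n * QuatOPUC.evalR (QuatOPUC.psiL (QuatOPUC.moment μ) n) p * p)) := by
  refine (and_iff_left_of_imp ?_).2 ?_
  · -- the assertion on measures is that on sequences, applied to the moments
    intro h i j μ _ _ _ _ hμ h0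
    exact h (QuatOPUC.moment μ) hμ h0
  intro c hc h0 n
  refine ⟨QuatOPUC.norm_verblunsky_lt_one (QuatOPUC.normSzego_pos hc h0 n)
      (QuatOPUC.normSzego_pos hc h0 (n + 1)), fun p => ⟨?_, ?_, ?_, ?_⟩⟩
  · rw [QuatOPUC.psiL_succ hc h0, QuatOPUC.evalR_real_smul, QuatOPUC.evalR_sub,
      QuatOPUC.evalR_X_mul, QuatOPUC.evalR_C_mul]
  · rw [QuatOPUC.reversePoly_psiL_succ hc h0, QuatOPUC.evalL_real_smul, QuatOPUC.evalL_sub,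
      QuatOPUC.evalL_mul_C, QuatOPUC.evalL_X_mul]
  · rw [QuatOPUC.psiR_succ hc h0, QuatOPUC.evalL_real_smul, QuatOPUC.evalL_sub,
      QuatOPUC.evalL_X_mul, QuatOPUC.evalL_mul_C]
  · rw [QuatOPUC.reversePoly_psiR_succ hc h0, QuatOPUC.evalR_real_smul, QuatOPUC.evalR_sub,
      QuatOPUC.evalR_C_mul, QuatOPUC.evalR_X_mul, mul_assoc]
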